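/- Let $n\ge 1$, let $\{a_i\}$, $\{b_j\}$ be finite families of homogeneous polynomials in $\mathbb C[x_1,\dots,x_n]$, and let $\nu_i,\rho_j\in\mathbb C$ have non-negative real parts and satisfy $\sum_i \nu_i\deg a_i=\sum_j\rho_j\deg b_j$. Write $p^{\mathrm{tr}}(x)=\max_{\ell\in\operatorname{supp} p}x^{\ell}$ for the tropical approximation of a polynomial $p$, and let $$\mathcal A=\sum_i(\operatorname{Re}\nu_i)\,\mathrm{NP}_{a_i},\qquad \mathcal B=\sum_j(\operatorname{Re}\rho_j)\,\mathrm{NP}_{b_j}$$ be the weighted Minkowski sums of the Newton polytopes. Suppose that $\mathcal A$ and $\mathcal B$ are generalized permutahedra (polytopes in $\mathbb R^n$ whose normal fans are coarsenings of the normal fan of the permutahedron, the convex hull of the points $(\sigma(1),\dots,\sigma(n))$, $\sigma\in S_n$), with associated functions $z_{\mathcal A},z_{\mathcal B}:2^{[n]}\to\mathbb R$; that is, $z=z_{\mathcal A}$ and $z=z_{\mathcal B}$ are supermodular ($z(S)+z(T)\le z(S\cap T)+z(S\cup T)$ for all $S,T\subseteq[n]$), satisfy $z(\emptyset)=0$,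 and describe the respective polytope as $$\Big\{v\in\mathbb R^n:\ \sum_{i\in[n]}v_i=z([n])\ \text{ and }\ \sum_{i\in I}v_i\ge z(I)\ \text{ for all } I\subseteq[n]\Big\}.$$ Suppose further that (R1) $\mathcal B$ is $(n-1)$-dimensional and (R2) $\mathcal A$ is contained in the relative interior of $\mathcal B$. For $S\subseteq[n]$ put $r(S)=z_{\mathcal A}(S)-z_{\mathcal B}(S)$. For $\sigma\in S_n$ put $A_k^\sigma=\{\sigma(1),\dots,\sigma(k)\}$, and for $\xi\in[0,1]^{n-1}$ define $x^{(\sigma)}(\xi)$ by $x_{\sigma(k)}=\prod_{i=k}^{n-1}\xi_i^{1/r(A_i^\sigma)}$ for $1\le k\le n-1$ and $x_{\sigma(n)}=1$. Then the following hold. 1. $r(S)>0$ for every non-empty proper subset $S\subsetneq[n]$. 2. For every $\sigma\in S_n$ and $\xi\in(0,1]^{n-1}$, the point $x^{(\sigma)}(\xi)$ lies in the image of the Weyl chamber $\{y: y_{\sigma(1)}\le\dots\le y_{\sigma(n)}\}$ under the component-wise exponential. 3. Let $f:\mathbb P^{n-1}_{>0}\to\mathbb C$ be measurable, i.e. a measurable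 function of degree-$0$ homogeneity on the positive orthant, where $\mathbb P^{n-1}_{>0}$ is the positive orthant modulo positive scaling. The integral $$I[f]=\int_{\mathbb P^{n-1}_{>0}}\frac{\prod_i a_i^{\mathrm{tr}}(x)^{\operatorname{Re}\nu_i}}{\prod_j b_j^{\mathrm{tr}}(x)^{\operatorname{Re}\rho_j}}\,f(x)\,\Omega,\qquad \Omega=\sum_{k=1}^n(-1)^{n-k}\frac{dx_1}{x_1}\wedge\dots\wedge\widehat{\frac{dx_k}{x_k}}\wedge\dots\wedge\frac{dx_n}{x_n},$$ with the orientation given by the chart $(x_1,\dots,x_{n-1})\mapsto[x_1:\dots:x_{n-1}:1]$, converges absolutely if and only if $\int_{[0,1]^{n-1}}f(x^{(\sigma)}(\xi))\,d\xi$ converges absolutely for every $\sigma\in S_n$, and in that case $$I[f]=\sum_{\sigma\in S_n}\frac{1}{\prod_{k=1}^{n-1}r(A_k^\sigma)}\int_{[0,1]^{n-1}}f\big(x^{(\sigma)}(\xi)\big)\prod_{k=1}^{n-1}d\xi_k .$$ -/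

import Mathlib

namespace TropicalSector

open MeasureTheory
open scoped Pointwise

noncomputable section

/-! ### Polytopes and their normal fans -/

/-- A polytope: a bounded intersection of finitely many closed half-spaces. -/
def IsPolytope {n : ℕ} (P : Set (Fin n → ℝ)) : Prop :=
  Bornology.IsBounded P ∧
    ∃ H : Set ((Fin n → ℝ) × ℝ), H.Finite ∧ P = {v | ∀ h ∈ H, h.1 ⬝ᵥ v ≤ h.2}

/-- `F` is a face of `P`: it is cut out of `P` by a hyperplane that bounds a half-space
containing `P`. -/
def IsFace {n : ℕ} (P F : Set (Fin n → ℝ)) : Prop :=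
  ∃ (y : Fin n → ℝ) (c : ℝ), P ⊆ {v | y ⬝ᵥ v ≤ c} ∧ F = P ∩ {v | y ⬝ᵥ v = c}

/-- The normal cone of a face `F` of `P`: all linear functionals whose maximum over `P` is attained
at every point of `F`. -/
def normalCone {n : ℕ} (P F : Set (Fin n → ℝ)) : Set (Fin n → ℝ) :=
  {y | ∀ v ∈ F, ∀ w ∈ P, y ⬝ᵥ w ≤ y ⬝ᵥ v}

/-- The normal fan of `P`: the normal cones of its non-empty faces. -/
def normalFan {n : ℕ} (P : Set (Fin n → ℝ)) : Set (Set (Fin n → ℝ)) :=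
  {C | ∃ F, IsFace P F ∧ F.Nonempty ∧ C = normalCone P F}

/-- The family of cones `𝓕'` refines `𝓕` (and `𝓕` is a coarsening of `𝓕'`): every member of `𝓕` is a
union of members of `𝓕'`. -/
def Refines {n : ℕ} (𝓕' 𝓕 : Set (Set (Fin n → ℝ))) : Prop :=
  ∀ C ∈ 𝓕, ∃ S ⊆ 𝓕', C = ⋃₀ S

/-- The permutahedron: the convex hull of the points `(σ(1), …, σ(n))`, `σ ∈ Sₙ`.
(`Fin n` counts from `0`, hence the `+ 1`.) -/
def permutahedron (n : ℕ) : Set (Fin n → ℝ) :=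
  convexHull ℝ (Set.range fun (σ : Equiv.Perm (Fin n)) (i : Fin n) => ((σ i : ℕ) : ℝ) + 1)

/-- A generalized permutahedron: a polytope whose normal fan is a coarsening of the braid arrangement
fan, i.e. of the normal fan of the permutahedron. -/
def IsGeneralizedPermutahedron {n : ℕ} (P : Set (Fin n → ℝ)) : Prop :=
  IsPolytope P ∧ Refines (normalFan (permutahedron n)) (normalFan P)

/-- The polyhedron given by a function `z` on subsets of `{1, …, n}`: the coordinate sum is `z([n])`
and every partial coordinate sum over `I` is at least `z(I)`. -/
def facetPolytope {n : ℕ} (z : Finset (Fin n) → ℝ) : Set (Fin n → ℝ) :=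
  {v | ∑ i, v i = z Finset.univ ∧ ∀ I : Finset (Fin n), z I ≤ ∑ i ∈ I, v i}

/-- Supermodularity of a function on the subsets of `{1, …, n}`. -/
def IsSupermodular {n : ℕ} (z : Finset (Fin n) → ℝ) : Prop :=
  ∀ S T : Finset (Fin n), z S + z T ≤ z (S ∩ T) + z (S ∪ T)

/-- `z` is the function associated with the generalized permutahedron `P`: the supermodular function,
zero at the empty set, that describes `P` by inequalities. -/
structure IsAssociatedFunction {n : ℕ} (z : Finset (Fin n) → ℝ) (P : Set (Fin n → ℝ)) : Prop where
  empty : z ∅ = 0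
  supermodular : IsSupermodular z
  eq_facetPolytope : P = facetPolytope z

/-- The weighted Minkowski sum `∑ᵢ cᵢ Pᵢ`. -/
def weightedMinkowskiSum {n : ℕ} {ι : Type*} [Fintype ι] (c : ι → ℝ) (P : ι → Set (Fin n → ℝ)) :
    Set (Fin n → ℝ) :=
  ∑ i, c i • P i

/-! ### Polynomials -/

/-- The Newton polytope: the convex hull of the exponent vectors in the support. -/
def newtonPolytope {n : ℕ} (p : MvPolynomial (Fin n) ℂ) : Set (Fin n → ℝ) :=
  convexHull ℝ ((fun (l : Fin n →₀ ℕ) (k : Fin n) => (l k : ℝ)) '' (p.support : Set (Fin n →₀ ℕ)))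

/-- The tropical approximation `pᵗʳ(x)`: the maximum of the monomials `x ^ l` over the exponents `l` in
the (finite) support of `p`. -/
def tropicalApprox {n : ℕ} (p : MvPolynomial (Fin n) ℂ) (x : Fin n → ℝ) : ℝ :=
  ⨆ l : p.support, ∏ k, x k ^ ((l : Fin n →₀ ℕ) k)

/-- The tropical integrand `∏ᵢ aᵢᵗʳ(x) ^ Re νᵢ / ∏ⱼ bⱼᵗʳ(x) ^ Re ρⱼ`. -/
def tropicalRatio {n : ℕ} {ι κ : Type*} [Fintype ι] [Fintype κ]
    (a : ι → MvPolynomial (Fin n) ℂ) (ν : ι → ℂ) (b : κ → MvPolynomial (Fin n) ℂ) (ρ : κ → ℂ)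
    (x : Fin n → ℝ) : ℝ :=
  (∏ i, tropicalApprox (a i) x ^ (ν i).re) / ∏ j, tropicalApprox (b j) x ^ (ρ j).re

/-! ### Integration over the positive part of projective space

Here `n = m + 1`. A function on `ℙ^m_{>0}`, the positive orthant of `ℝ^(m+1)` modulo positive scaling,
is given as a function on the positive orthant that is homogeneous of degree `0`. -/

/-- The open positive orthant. -/
def positiveOrthant (n : ℕ) : Set (Fin n → ℝ) := {x | ∀ k, 0 < x k}

/-- `f` is a measurable function on `ℙ^(n-1)_{>0}`, i.e. measurable and homogeneous of degree `0` on the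
positive orthant (its values elsewhere are irrelevant). -/
structure IsMeasurableHomogeneous {n : ℕ} (f : (Fin n → ℝ) → ℂ) : Prop where
  measurable : Measurable fun x : positiveOrthant n => f x
  homogeneous : ∀ c : ℝ, 0 < c → ∀ x ∈ positiveOrthant n, f (c • x) = f x

/-- The differential form
`Ω = ∑ₖ (-1)^(n-k) dx₁/x₁ ∧ … ∧ (omit dxₖ/xₖ) ∧ … ∧ dxₙ/xₙ`, `n = m + 1`, at the point `x`, evaluated
on the `m` tangent vectors `v`. The wedge product of `m` one-forms evaluates to the determinant of
their values. (`Fin (m + 1)` counts from `0`, so `n - k` becomes `m - k`.) -/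
def canonicalForm {m : ℕ} (x : Fin (m + 1) → ℝ) (v : Fin m → Fin (m + 1) → ℝ) : ℝ :=
  ∑ k : Fin (m + 1), (-1 : ℝ) ^ (m - (k : ℕ)) *
    (Matrix.of fun i j : Fin m => v i (k.succAbove j) / x (k.succAbove j)).det

/-- The affine chart `t ↦ [t₁ : … : tₘ : 1]`, a bijection of the positive orthant of `ℝ^m` with
`ℙ^m_{>0}`. -/
def affineChart {m : ℕ} (t : Fin m → ℝ) : Fin (m + 1) → ℝ := Fin.snoc t 1

/-- The coordinate tangent vectors of the affine chart: the partial derivatives of `affineChart`. -/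
def chartTangent {m : ℕ} (i : Fin m) : Fin (m + 1) → ℝ := Pi.single i.castSucc 1

/-- The coefficient of `dt₁ ∧ … ∧ dtₘ` in the pullback of `g Ω` under the affine chart. -/
def projectiveIntegrand {m : ℕ} (g : (Fin (m + 1) → ℝ) → ℂ) (t : Fin m → ℝ) : ℂ :=
  g (affineChart t) * (canonicalForm (affineChart t) chartTangent : ℝ)

/-- Absolute convergence of `∫ g Ω` over `ℙ^m_{>0}`, for `g` homogeneous of degree `0`. -/
def ProjectiveIntegrable {m : ℕ} (g : (Fin (m + 1) → ℝ) → ℂ) : Prop :=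
  IntegrableOn (projectiveIntegrand g) (positiveOrthant m)

/-- The integral `∫ g Ω` over `ℙ^m_{>0}`, for `g` homogeneous of degree `0`. -/
def projectiveIntegral {m : ℕ} (g : (Fin (m + 1) → ℝ) → ℂ) : ℂ :=
  ∫ t in positiveOrthant m, projectiveIntegrand g t

/-! ### The sectors -/

/-- `A_k^σ = {σ(1), …, σ(k)}`. -/
def prefixSet {n : ℕ} (σ : Equiv.Perm (Fin n)) (k : ℕ) : Finset (Fin n) :=
  (Finset.univ.filter fun i : Fin n => (i : ℕ) < k).map σ.toEmbedding

/-- The Weyl chamber `y_{σ(1)} ≤ … ≤ y_{σ(n)}`. -/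
def weylChamber {n : ℕ} (σ : Equiv.Perm (Fin n)) : Set (Fin n → ℝ) :=
  {y | ∀ i j : Fin n, i ≤ j → y (σ i) ≤ y (σ j)}

/-- The image of the Weyl chamber under the componentwise exponential. -/
def expWeylChamber {n : ℕ} (σ : Equiv.Perm (Fin n)) : Set (Fin n → ℝ) :=
  (fun y k => Real.exp (y k)) '' weylChamber σ

/-- The point `x^(σ)(ξ)`, with `x_{σ(k)} = ∏_{i = k}^{n-1} ξᵢ ^ (1 / r(A_i^σ))`; in particular
`x_{σ(n)} = 1`. (Here `n = m + 1`; the index `i : Fin m` counts from `0` and stands for the one-based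
index `i + 1 ∈ {1, …, n - 1}`.) -/
def sectorPoint {m : ℕ} (r : Finset (Fin (m + 1)) → ℝ) (σ : Equiv.Perm (Fin (m + 1)))
    (ξ : Fin m → ℝ) : Fin (m + 1) → ℝ :=
  fun j => ∏ i ∈ Finset.univ.filter (fun i : Fin m => (σ.symm j : ℕ) ≤ (i : ℕ)),
    ξ i ^ (1 / r (prefixSet σ ((i : ℕ) + 1)))

/-- The closed unit cube `[0,1]^m`. -/
def unitCube (m : ℕ) : Set (Fin m → ℝ) := {ξ | ∀ i, 0 ≤ ξ i ∧ ξ i ≤ 1}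

end

end TropicalSector

open TropicalSector MeasureTheory

namespace TropicalSector
open scoped Pointwise

noncomputable section

/-! ### Vertices and support functions of generalized permutahedra -/

section Prefix

variable {n : ℕ} (σ : Equiv.Perm (Fin n))

/-! In coordinates `x = exp y`, the logarithm of `pᵗʳ` is the support function of the Newton
polytope of `p`. Support functions add under Minkowski sums with non-negative weights, so the
tropical numerator and denominator are exponentials of the support functions of `A` and `B`. For a
polytope given by a supermodular `z`, the maximum of `y` over a whole Weyl chamber is attained at
one greedy vertex. The support function is therefore linear there, with coefficients `z (A_k^σ)` in
the coordinates `u ≤ 0` of `chamberPoint` (`isGreatest_facetPolytope`, `prod_tropicalApprox_rpow`).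
Hence the integrand is `exp (∑ r (A_k^σ) u_k) f`, and `ξ_k = exp (r (A_k^σ) u_k)` absorbs the
exponential into the Jacobian. In the logarithmic chart `Ω` is Lebesgue measure. The open chambers
fill the chart up to a null set, and the passage to `u` has determinant `±1`. Positivity of `r`
holds because the bound `z_A S` is attained on `A`, whose points satisfy every proper inequality of
`B` strictly (`lt_sum_of_mem_intrinsicInterior`). -/

@[simp] lemma mem_prefixSet {k : ℕ} {j : Fin n} : j ∈ prefixSet σ k ↔ (σ.symm j : ℕ) < k := by
  simp only [prefixSet, Finset.mem_map, Finset.mem_filter, Finset.mem_univ, true_and,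
    Equiv.coe_toEmbedding]
  constructor
  · rintro ⟨i, hi, rfl⟩
    simpa using hi
  · exact fun h => ⟨σ.symm j, h, by simp⟩

@[simp] lemma prefixSet_zero : prefixSet σ 0 = ∅ := by ext; simp

@[simp] lemma prefixSet_self : prefixSet σ n = Finset.univ := by ext; simp

lemma prefixSet_succ (k : Fin n) :
    prefixSet σ ((k : ℕ) + 1) = insert (σ k) (prefixSet σ k) := by
  ext j
  simp only [mem_prefixSet, Finset.mem_insert, ← Equiv.symm_apply_eq, Fin.ext_iff]
  omega

lemma apply_notMem_prefixSet (k : Fin n) : σ k ∉ prefixSet σ k := by simp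

/-- The vertex `v_{σ(k)} = z(A_k^σ) - z(A_{k-1}^σ)` of `facetPolytope z`. -/
def greedyVertex (z : Finset (Fin n) → ℝ) : Fin n → ℝ := fun j =>
  z (prefixSet σ ((σ.symm j : ℕ) + 1)) - z (prefixSet σ (σ.symm j))

variable {z : Finset (Fin n) → ℝ}

lemma sum_greedyVertex_prefixSet (h0 : z ∅ = 0) {k : ℕ} (hk : k ≤ n) :
    ∑ j ∈ prefixSet σ k, greedyVertex σ z j = z (prefixSet σ k) := by
  induction k with
  | zero => simp [h0]
  | succ k ih =>
    have := prefixSet_succ σ ⟨k, hk⟩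
    simp only at this
    rw [this, Finset.sum_insert (apply_notMem_prefixSet σ ⟨k, hk⟩), ih (by omega), ← this]
    simp [greedyVertex]

/-- Increasing marginals: if `σ k ∈ I`, supermodularity says that adding `σ k` to `I ∩ A_k` raises
`z` by at most what adding it to `A_k` does, which is the greedy coordinate. -/
lemma le_sum_greedyVertex_inter (h0 : z ∅ = 0) (hz : IsSupermodular z) (I : Finset (Fin n))
    {k : ℕ} (hk : k ≤ n) :
    z (I ∩ prefixSet σ k) ≤ ∑ j ∈ I ∩ prefixSet σ k, greedyVertex σ z j := by
  induction k with
  | zero => simp [h0]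
  | succ k ih =>
    have hs := prefixSet_succ σ ⟨k, hk⟩
    have hn := apply_notMem_prefixSet σ ⟨k, hk⟩
    simp only at hs hn
    have ih := ih (by omega)
    by_cases hI : σ ⟨k, hk⟩ ∈ I
    · have h1 : I ∩ prefixSet σ (k + 1) = insert (σ ⟨k, hk⟩) (I ∩ prefixSet σ k) := by
        rw [hs, Finset.inter_insert_of_mem hI]
      have h2 := hz (I ∩ prefixSet σ (k + 1)) (prefixSet σ k)
      have h3 : I ∩ prefixSet σ (k + 1) ∩ prefixSet σ k = I ∩ prefixSet σ k := by
        ext; simp only [Finset.mem_inter, mem_prefixSet]; grind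
      have h4 : I ∩ prefixSet σ (k + 1) ∪ prefixSet σ k = prefixSet σ (k + 1) := by
        rw [h1, hs]; ext; simp only [Finset.mem_union, Finset.mem_insert, Finset.mem_inter]; tauto
      rw [h3, h4] at h2
      have h5 : ∑ j ∈ I ∩ prefixSet σ (k + 1), greedyVertex σ z j =
          z (prefixSet σ (k + 1)) - z (prefixSet σ k) +
            ∑ j ∈ I ∩ prefixSet σ k, greedyVertex σ z j := by
        rw [h1, Finset.sum_insert (fun h => hn (Finset.mem_inter.1 h).2)]
        simp [greedyVertex]
      linarith
    · rwa [hs, Finset.inter_insert_of_notMem hI]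

lemma greedyVertex_mem (h0 : z ∅ = 0) (hz : IsSupermodular z) :
    greedyVertex σ z ∈ facetPolytope z := by
  refine ⟨by simpa using sum_greedyVertex_prefixSet σ h0 le_rfl, fun I => ?_⟩
  simpa using le_sum_greedyVertex_inter σ h0 hz I le_rfl

/-- The lower bound on the coordinate sum over `S` is attained. -/
lemma exists_mem_facetPolytope_sum_eq (h0 : z ∅ = 0) (hz : IsSupermodular z)
    (S : Finset (Fin n)) : ∃ v ∈ facetPolytope z, ∑ i ∈ S, v i = z S := by
  -- Sorting by this indicator lists `S` first, so `S` itself becomes a prefix, where the greedy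
  -- vertex is tight.
  let y : Fin n → ℕ := fun i => if i ∈ S then 0 else 1
  let τ := Tuple.sort y
  have hmono : Monotone (y ∘ τ) := Tuple.monotone_sort y
  refine ⟨_, greedyVertex_mem τ h0 hz, ?_⟩
  have key : ∀ k, k ≤ n →
      ∑ j ∈ S ∩ prefixSet τ k, greedyVertex τ z j = z (S ∩ prefixSet τ k) := by
    intro k
    induction k with
    | zero => simp [h0]
    | succ k ih =>
      intro hk
      have hs := prefixSet_succ τ ⟨k, hk⟩
      simp only at hs
      by_cases hI : τ ⟨k, hk⟩ ∈ S
      · have hsub : S ∩ prefixSet τ (k + 1) = prefixSet τ (k + 1) := by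
          rw [Finset.inter_eq_right]
          intro j hj
          rw [mem_prefixSet] at hj
          have h := hmono (show τ.symm j ≤ ⟨k, hk⟩ from Fin.le_def.2 (by simpa using (by omega : _ ≤ k)))
          by_contra hjS
          simp [y, hI, hjS] at h
        rw [hsub, sum_greedyVertex_prefixSet τ h0 hk]
      · rw [hs, Finset.inter_insert_of_notMem hI]
        exact ih (by omega)
  simpa using key n le_rfl

end Prefix

/-- The point with coordinate `∑_{i ≥ k} u_i` at `σ(k)`. For `u ≤ 0` it lies in the Weyl chamber
of `σ`. -/
def chamberPoint {R : Type*} [AddCommMonoid R] {m : ℕ} (σ : Equiv.Perm (Fin (m + 1)))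
    (u : Fin m → R) : Fin (m + 1) → R :=
  fun j => ∑ i ∈ Finset.univ.filter (fun i : Fin m => (σ.symm j : ℕ) ≤ (i : ℕ)), u i

section Chamber

variable {m : ℕ} (σ : Equiv.Perm (Fin (m + 1)))

/-- Summation by parts: `u i` contributes to exactly the coordinates in the prefix of length `i +
1`. -/
lemma add_chamberPoint_dotProduct (c : ℝ) (u : Fin m → ℝ) (w : Fin (m + 1) → ℝ) :
    (fun j => c + chamberPoint σ u j) ⬝ᵥ w =
      c * ∑ j, w j + ∑ i : Fin m, u i * ∑ j ∈ prefixSet σ ((i : ℕ) + 1), w j := by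
  simp only [dotProduct, add_mul, Finset.sum_add_distrib, Finset.mul_sum, chamberPoint,
    Finset.sum_mul]
  congr 1
  refine Finset.sum_comm' fun j i => ?_
  simp

/-- Multiplying by `u i ≤ 0` turns the lower bounds on prefix sums into upper bounds; the greedy
vertex attains all of them at once. -/
lemma isGreatest_facetPolytope {z : Finset (Fin (m + 1)) → ℝ} (h0 : z ∅ = 0)
    (hz : IsSupermodular z) (c : ℝ) {u : Fin m → ℝ} (hu : ∀ i, u i ≤ 0) :
    IsGreatest ((fun w => (fun j => c + chamberPoint σ u j) ⬝ᵥ w) '' facetPolytope z)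
      (c * z Finset.univ + ∑ i : Fin m, u i * z (prefixSet σ ((i : ℕ) + 1))) := by
  constructor
  · refine ⟨greedyVertex σ z, greedyVertex_mem σ h0 hz, ?_⟩
    simp only [add_chamberPoint_dotProduct]
    rw [(greedyVertex_mem σ h0 hz).1]
    congr 1
    refine Finset.sum_congr rfl fun i _ => ?_
    rw [sum_greedyVertex_prefixSet σ h0 (by omega)]
  · rintro _ ⟨w, hw, rfl⟩
    simp only [add_chamberPoint_dotProduct]
    rw [hw.1]
    gcongr 1
    exact Finset.sum_le_sum fun i _ => mul_le_mul_of_nonpos_left (hw.2 _) (hu i)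

lemma isGreatest_weightedMinkowskiSum {n : ℕ} {ι : Type*} [Fintype ι] {c : ι → ℝ}
    (hc : ∀ i, 0 ≤ c i) {P : ι → Set (Fin n → ℝ)} {y : Fin n → ℝ} {h : ι → ℝ}
    (hP : ∀ i, IsGreatest ((fun w => y ⬝ᵥ w) '' P i) (h i)) :
    IsGreatest ((fun w => y ⬝ᵥ w) '' weightedMinkowskiSum c P) (∑ i, c i * h i) := by
  have hmem : ∀ v, v ∈ weightedMinkowskiSum c P ↔
      ∃ g : ι → Fin n → ℝ, (∀ i, g i ∈ P i) ∧ ∑ i, c i • g i = v := by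
    intro v
    rw [weightedMinkowskiSum, Set.mem_finsetSum]
    constructor
    · rintro ⟨g, hg, rfl⟩
      have : ∀ i, ∃ w ∈ P i, c i • w = g i := fun i => hg (Finset.mem_univ i)
      choose w hw hwg using this
      exact ⟨w, hw, by simp [hwg]⟩
    · rintro ⟨g, hg, rfl⟩
      exact ⟨fun i => c i • g i, fun {i} _ => Set.smul_mem_smul_set (hg i), rfl⟩
  constructor
  · choose w hw hwh using fun i => (hP i).1
    refine ⟨_, (hmem _).2 ⟨w, hw, rfl⟩, ?_⟩
    simp only [dotProduct_sum, dotProduct_smul, smul_eq_mul]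
    exact Finset.sum_congr rfl fun i _ => by rw [← hwh i]
  · rintro _ ⟨v, hv, rfl⟩
    obtain ⟨g, hg, rfl⟩ := (hmem v).1 hv
    simp only [dotProduct_sum, dotProduct_smul, smul_eq_mul]
    exact Finset.sum_le_sum fun i _ =>
      mul_le_mul_of_nonneg_left ((hP i).2 ⟨_, hg i, rfl⟩) (hc i)

/-- A linear functional on a convex hull is maximal at a generator. For `p = 0` the polytope is
empty and the supremum takes the default value `0`, which is no exponential. -/
lemma exists_isGreatest_newtonPolytope {n : ℕ} {p : MvPolynomial (Fin n) ℂ} (hp : p ≠ 0)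
    (y : Fin n → ℝ) :
    ∃ h, IsGreatest ((fun w => y ⬝ᵥ w) '' newtonPolytope p) h ∧
      tropicalApprox p (fun k => Real.exp (y k)) = Real.exp h := by
  have hne : p.support.Nonempty := by simpa using hp
  let e : (Fin n →₀ ℕ) → ℝ := fun l => y ⬝ᵥ (fun k => (l k : ℝ))
  have hmono : ∀ l : Fin n →₀ ℕ, ∏ k, Real.exp (y k) ^ l k = Real.exp (e l) := by
    intro l
    simp only [e, dotProduct, Real.exp_sum]
    exact Finset.prod_congr rfl fun k _ => by rw [mul_comm, Real.exp_nat_mul]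
  obtain ⟨l₀, hl₀, hmax⟩ := p.support.exists_max_image e hne
  refine ⟨e l₀, ⟨⟨_, subset_convexHull ℝ _ ⟨l₀, hl₀, rfl⟩, rfl⟩, ?_⟩, ?_⟩
  · rintro _ ⟨w, hw, rfl⟩
    have hconv : Convex ℝ {w : Fin n → ℝ | y ⬝ᵥ w ≤ e l₀} :=
      convex_halfSpace_le ⟨fun a b => dotProduct_add y a b, fun c a => dotProduct_smul c y a⟩ _
    refine convexHull_min ?_ hconv hw
    rintro _ ⟨l, hl, rfl⟩
    exact hmax l hl
  · have : Nonempty p.support := ⟨⟨l₀, hl₀⟩⟩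
    simp only [tropicalApprox, hmono]
    refine le_antisymm (ciSup_le fun l => Real.exp_le_exp.2 (hmax l l.2)) ?_
    exact le_ciSup (f := fun l : p.support => Real.exp (e l)) (Set.finite_range _).bddAbove ⟨l₀, hl₀⟩

/-- One empty summand empties the whole sum, even with weight zero. -/
lemma weightedMinkowskiSum_newtonPolytope_ne_zero {n : ℕ} {ι : Type*} [Fintype ι] {c : ι → ℝ}
    {a : ι → MvPolynomial (Fin n) ℂ}
    (h : (weightedMinkowskiSum c fun i => newtonPolytope (a i)).Nonempty) (i : ι) : a i ≠ 0 := by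
  rintro h0
  obtain ⟨v, hv⟩ := h
  rw [weightedMinkowskiSum, Set.mem_finsetSum] at hv
  obtain ⟨g, hg, -⟩ := hv
  have := hg (Finset.mem_univ i)
  simp [h0, newtonPolytope] at this

/-- The tropical approximation of `∏ aᵢ ^ cᵢ` on a Weyl chamber, in terms of the associated function
of the weighted sum of Newton polytopes. -/
lemma prod_tropicalApprox_rpow {ι : Type*} [Fintype ι] {c : ι → ℝ} (hc : ∀ i, 0 ≤ c i)
    {a : ι → MvPolynomial (Fin (m + 1)) ℂ} {z : Finset (Fin (m + 1)) → ℝ}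
    (hz : IsAssociatedFunction z (weightedMinkowskiSum c fun i => newtonPolytope (a i)))
    (s : ℝ) {u : Fin m → ℝ} (hu : ∀ i, u i ≤ 0) :
    ∏ i, tropicalApprox (a i) (fun j => Real.exp (s + chamberPoint σ u j)) ^ c i =
      Real.exp (s * z Finset.univ + ∑ i : Fin m, u i * z (prefixSet σ ((i : ℕ) + 1))) := by
  have hne : (weightedMinkowskiSum c fun i => newtonPolytope (a i)).Nonempty := by
    rw [hz.eq_facetPolytope]; exact ⟨_, greedyVertex_mem 1 hz.empty hz.supermodular⟩
  choose h hP hexp using fun i => exists_isGreatest_newtonPolytope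
    (weightedMinkowskiSum_newtonPolytope_ne_zero hne i) (fun j => s + chamberPoint σ u j)
  have h1 := isGreatest_weightedMinkowskiSum hc hP
  rw [hz.eq_facetPolytope] at h1
  rw [← h1.unique (isGreatest_facetPolytope σ hz.empty hz.supermodular s hu), Real.exp_sum]
  refine Finset.prod_congr rfl fun i _ => ?_
  rw [hexp, ← Real.exp_mul, mul_comm]

end Chamber

/-! ### Strict positivity of `r` -/

/-- By dimension, the directions of the affine span are all vectors of coordinate sum zero. A
relative interior point can thus move a little along `e_j - e_i` with `i ∈ S`, `j ∉ S`; this lowers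
the sum over `S`, so the inequality had slack. -/
lemma lt_sum_of_mem_intrinsicInterior {m : ℕ} {z : Finset (Fin (m + 1)) → ℝ}
    (hdim : Module.finrank ℝ (vectorSpan ℝ (facetPolytope z)) = m) {v : Fin (m + 1) → ℝ}
    (hv : v ∈ intrinsicInterior ℝ (facetPolytope z)) {S : Finset (Fin (m + 1))}
    (hS : S.Nonempty) (hS' : S ≠ Finset.univ) : z S < ∑ i ∈ S, v i := by
  obtain ⟨i, hi⟩ := hS
  obtain ⟨j, hj⟩ : ∃ j, j ∉ S := by
    by_contra! h
    exact hS' (Finset.eq_univ_iff_forall.2 h)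
  let φ : (Fin (m + 1) → ℝ) →ₗ[ℝ] ℝ := ∑ k, LinearMap.proj k
  have hφ : ∀ w, φ w = ∑ k, w k := fun w => by simp [φ]
  have hle : vectorSpan ℝ (facetPolytope z) ≤ LinearMap.ker φ := by
    rw [vectorSpan, Submodule.span_le]
    rintro _ ⟨a, ha, b, hb, rfl⟩
    simp [hφ, ha.1, hb.1]
  have hker : Module.finrank ℝ (LinearMap.ker φ) = m := by
    have hsurj : LinearMap.range φ = ⊤ := by
      rw [LinearMap.range_eq_top]
      intro t
      exact ⟨Pi.single 0 t, by simp [hφ]⟩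
    have := φ.finrank_range_add_finrank_ker
    rw [hsurj] at this
    simp at this
    omega
  have heq := Submodule.eq_of_le_of_finrank_eq hle (hdim.trans hker.symm)
  let d : Fin (m + 1) → ℝ := Pi.single j 1 - Pi.single i 1
  have hd : d ∈ vectorSpan ℝ (facetPolytope z) := by
    rw [heq]; simp [hφ, d]
  rw [mem_intrinsicInterior] at hv
  obtain ⟨⟨v', hv'⟩, hint, rfl⟩ := hv
  have hmem : ∀ t : ℝ, t • d + v' ∈ affineSpan ℝ (facetPolytope z) := fun t =>
    AffineSubspace.vadd_mem_of_mem_direction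
      (by rw [direction_affineSpan]; exact Submodule.smul_mem _ _ hd) hv'
  -- Relative interior means interior inside the affine span, so the segment is taken as a path in
  -- that subtype.
  let path : ℝ → affineSpan ℝ (facetPolytope z) := fun t => ⟨t • d + v', hmem t⟩
  have hcont : Continuous path := by
    refine Continuous.subtype_mk ?_ _
    fun_prop
  have hnhds : path ⁻¹' interior (Subtype.val ⁻¹' facetPolytope z) ∈ nhds (0 : ℝ) := by
    refine (isOpen_interior.preimage hcont).mem_nhds ?_
    simpa [path] using hint
  obtain ⟨ε, hε, hball⟩ := Metric.mem_nhds_iff.1 hnhds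
  have hmemε : (ε / 2) • d + v' ∈ facetPolytope z := by
    have : ε / 2 ∈ Metric.ball (0 : ℝ) ε := by
      rw [Metric.mem_ball, Real.dist_eq, sub_zero, abs_of_pos (by positivity)]
      linarith
    exact (interior_subset (hball this) : path (ε / 2) ∈ Subtype.val ⁻¹' facetPolytope z)
  have h := hmemε.2 S
  have hsum : ∑ k ∈ S, d k = -1 := by
    simp [d, Finset.sum_sub_distrib, hi, hj]
  simp only [Pi.add_apply, Pi.smul_apply, smul_eq_mul, Finset.sum_add_distrib, ← Finset.mul_sum,
    hsum] at h
  change z S < ∑ k ∈ S, v' k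
  linarith

/-! ### Changes of variables -/

section ExpScale

variable {m : ℕ}

/-- The coordinatewise substitution `u ↦ exp (c u)`. -/
def expScale (c u : Fin m → ℝ) : Fin m → ℝ := fun i => Real.exp (c i * u i)

lemma hasFDerivAt_expScale (c u : Fin m → ℝ) :
    HasFDerivAt (expScale c) (ContinuousLinearMap.pi fun i =>
      ((c i * expScale c u i) • ContinuousLinearMap.id ℝ ℝ) ∘SL ContinuousLinearMap.proj i) u := by
  refine hasFDerivAt_pi.2 fun i => ?_
  have h1 : HasFDerivAt (fun u : Fin m → ℝ => u i)
      (ContinuousLinearMap.proj (R := ℝ) (φ := fun _ : Fin m => ℝ) i) u :=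
    (ContinuousLinearMap.proj (R := ℝ) (φ := fun _ : Fin m => ℝ) i).hasFDerivAt
  refine (h1.const_mul (c i)).exp.congr_fderiv (ContinuousLinearMap.ext fun v => ?_)
  change Real.exp (c i * u i) * (c i * v i) = c i * Real.exp (c i * u i) * v i
  ring

lemma abs_det_expScale {c : Fin m → ℝ} (hc : ∀ i, 0 < c i) (u : Fin m → ℝ) :
    |(ContinuousLinearMap.pi fun i : Fin m => ((c i * expScale c u i) •
      ContinuousLinearMap.id ℝ ℝ) ∘SL ContinuousLinearMap.proj (φ := fun _ : Fin m => ℝ) i).det| =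
      ∏ i, c i * expScale c u i := by
  rw [ContinuousLinearMap.det_pi]
  have : ∀ i, ((c i * expScale c u i) • ContinuousLinearMap.id ℝ ℝ).det = c i * expScale c u i := by
    intro i
    simp [ContinuousLinearMap.det]
  simp only [this]
  exact abs_of_pos (Finset.prod_pos fun i _ => mul_pos (hc i) (Real.exp_pos _))

lemma expScale_injective {c : Fin m → ℝ} (hc : ∀ i, 0 < c i) :
    Function.Injective (expScale c) := by
  intro u v h
  ext i
  have := Real.exp_injective (congrFun h i)
  exact mul_left_cancel₀ (hc i).ne' this

lemma integrableOn_image_expScale {c : Fin m → ℝ} (hc : ∀ i, 0 < c i) {s : Set (Fin m → ℝ)}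
    (hs : MeasurableSet s) (F : (Fin m → ℝ) → ℂ) :
    IntegrableOn F (expScale c '' s) ↔
      IntegrableOn (fun u => (∏ i, c i * expScale c u i) • F (expScale c u)) s := by
  rw [integrableOn_image_iff_integrableOn_abs_det_fderiv_smul volume hs
    (fun u _ => (hasFDerivAt_expScale c u).hasFDerivWithinAt) (expScale_injective hc).injOn]
  simp only [abs_det_expScale hc]

lemma integral_image_expScale {c : Fin m → ℝ} (hc : ∀ i, 0 < c i) {s : Set (Fin m → ℝ)}
    (hs : MeasurableSet s) (F : (Fin m → ℝ) → ℂ) :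
    ∫ t in expScale c '' s, F t = ∫ u in s, (∏ i, c i * expScale c u i) • F (expScale c u) := by
  rw [integral_image_eq_integral_abs_det_fderiv_smul volume hs
    (fun u _ => (hasFDerivAt_expScale c u).hasFDerivWithinAt) (expScale_injective hc).injOn]
  simp only [abs_det_expScale hc]

lemma image_expScale_univ : expScale 1 '' (Set.univ : Set (Fin m → ℝ)) = positiveOrthant m := by
  ext t
  constructor
  · rintro ⟨u, -, rfl⟩ i
    exact Real.exp_pos _
  · intro ht
    refine ⟨fun i => Real.log (t i), trivial, ?_⟩
    ext i
    simp [expScale, Real.exp_log (ht i)]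

/-- The open negative orthant. -/
def negativeOrthant (m : ℕ) : Set (Fin m → ℝ) := {u | ∀ i, u i < 0}

lemma measurableSet_negativeOrthant : MeasurableSet (negativeOrthant m) := by
  have : negativeOrthant m = ⋂ i, {u | u i < 0} := by ext; simp [negativeOrthant]
  rw [this]
  exact MeasurableSet.iInter fun i => measurableSet_lt (measurable_pi_apply i) measurable_const

lemma image_expScale_negativeOrthant {c : Fin m → ℝ} (hc : ∀ i, 0 < c i) :
    expScale c '' negativeOrthant m = Set.univ.pi fun _ => Set.Ioo 0 1 := by
  ext t
  simp only [Set.mem_pi, Set.mem_univ, true_implies, Set.mem_Ioo]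
  constructor
  · rintro ⟨u, hu, rfl⟩ i
    exact ⟨Real.exp_pos _, by
      rw [expScale, Real.exp_lt_one_iff]; exact mul_neg_of_pos_of_neg (hc i) (hu i)⟩
  · intro ht
    refine ⟨fun i => Real.log (t i) / c i,
      fun i => div_neg_of_neg_of_pos (Real.log_neg (ht i).1 (ht i).2) (hc i), ?_⟩
    ext i
    rw [expScale, mul_div_cancel₀ _ (hc i).ne', Real.exp_log (ht i).1]

/-- Discards the null boundary of the cube, including the faces `ξ i = 0`, which logarithmic
coordinates do not reach. -/
lemma image_expScale_ae_eq_unitCube {c : Fin m → ℝ} (hc : ∀ i, 0 < c i) :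
    unitCube m =ᵐ[volume] expScale c '' negativeOrthant m := by
  have : unitCube m = Set.Icc (fun _ => 0) (fun _ => 1) := by
    ext ξ
    simp only [unitCube, Set.mem_ofPred_eq, Set.mem_Icc, Pi.le_def, forall_and]
  rw [image_expScale_negativeOrthant hc, this]
  exact Measure.univ_pi_Ioo_ae_eq_Icc.symm

end ExpScale

/-! ### The decomposition of the chart into open chambers -/

section Chambers

variable {m : ℕ} (σ : Equiv.Perm (Fin (m + 1)))

section Telescoping

variable {R : Type*} [AddCommGroup R]

lemma chamberPoint_apply_last (u : Fin m → R) : chamberPoint σ u (σ (Fin.last m)) = 0 := by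
  rw [chamberPoint, Finset.filter_eq_empty_iff.2, Finset.sum_empty]
  intro i _
  simp

lemma chamberPoint_apply_castSucc (u : Fin m → R) (k : Fin m) :
    chamberPoint σ u (σ k.castSucc) = u k + chamberPoint σ u (σ k.succ) := by
  have : Finset.univ.filter (fun i : Fin m => (k : ℕ) ≤ (i : ℕ)) =
      insert k (Finset.univ.filter fun i : Fin m => (k : ℕ) + 1 ≤ (i : ℕ)) := by
    ext i
    simp only [Finset.mem_filter, Finset.mem_univ, true_and, Finset.mem_insert, Fin.ext_iff]
    omega
  simp only [chamberPoint, Equiv.symm_apply_apply, Fin.val_castSucc, Fin.val_succ]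
  rw [this, Finset.sum_insert (by simp)]

/-- Telescoping: successive differences along `σ` invert `chamberPoint` up to a constant shift. -/
lemma chamberPoint_sub (Y : Fin (m + 1) → R) (j : Fin (m + 1)) :
    chamberPoint σ (fun k => Y (σ k.castSucc) - Y (σ k.succ)) j = Y j - Y (σ (Fin.last m)) := by
  obtain ⟨i, rfl⟩ := σ.surjective j
  induction i using Fin.reverseInduction with
  | last => simp [chamberPoint_apply_last]
  | cast i ih => rw [chamberPoint_apply_castSucc, ih]; abel

end Telescoping

/-- The matrix of `u ↦ chamberPoint σ u` followed by normalising the last coordinate to `0` and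
dropping it. -/
def chamberMatrix (R : Type*) [Ring R] : Matrix (Fin m) (Fin m) R :=
  Matrix.of fun j i => (if (σ.symm j.castSucc : ℕ) ≤ (i : ℕ) then 1 else 0) -
    (if (σ.symm (Fin.last m) : ℕ) ≤ (i : ℕ) then 1 else 0)

lemma chamberMatrix_mulVec {R : Type*} [CommRing R] (u : Fin m → R) (j : Fin m) :
    (chamberMatrix σ R).mulVec u j =
      chamberPoint σ u j.castSucc - chamberPoint σ u (Fin.last m) := by
  simp [Matrix.mulVec, dotProduct, chamberMatrix, chamberPoint, sub_mul, Finset.sum_sub_distrib,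
    Finset.sum_filter]

lemma snoc_chamberMatrix_mulVec (u : Fin m → ℝ) (j : Fin (m + 1)) :
    (Fin.snoc ((chamberMatrix σ ℝ).mulVec u) 0 : Fin (m + 1) → ℝ) j =
      chamberPoint σ u j - chamberPoint σ u (Fin.last m) := by
  induction j using Fin.lastCases with
  | last => simp
  | cast j => simp [chamberMatrix_mulVec]

/-- The matrix is integral and already surjective over `ℤ`, so its determinant is a unit of `ℤ`; no
expansion is needed. -/
lemma abs_det_chamberMatrix : |(chamberMatrix σ ℝ).det| = 1 := by
  have hsurj : Function.Surjective (chamberMatrix σ ℤ).mulVec := by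
    intro y
    let Y : Fin (m + 1) → ℤ := Fin.snoc y 0
    refine ⟨fun k => Y (σ k.castSucc) - Y (σ k.succ), ?_⟩
    ext j
    rw [chamberMatrix_mulVec, chamberPoint_sub, chamberPoint_sub]
    simp [Y]
  have hdet : IsUnit (chamberMatrix σ ℤ).det :=
    (Matrix.isUnit_iff_isUnit_det _).1 (Matrix.mulVec_surjective_iff_isUnit.1 hsurj)
  have hcast : chamberMatrix σ ℝ = (chamberMatrix σ ℤ).map (Int.castRingHom ℝ) := by
    ext i j
    simp [chamberMatrix]
  rw [hcast, ← RingHom.mapMatrix_apply, ← RingHom.map_det, eq_intCast, ← Int.cast_abs,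
    Int.isUnit_iff_abs_eq.1 hdet, Int.cast_one]

lemma measurePreserving_chamberMatrix :
    MeasurePreserving (Matrix.toLin' (chamberMatrix σ ℝ)) volume volume := by
  have h := abs_det_chamberMatrix σ
  have hne : (chamberMatrix σ ℝ).det ≠ 0 := fun h0 => by simp [h0] at h
  refine ⟨(LinearMap.continuous_of_finiteDimensional _).measurable, ?_⟩
  rw [Real.map_matrix_volume_pi_eq_smul_volume_pi hne, abs_inv, h]
  simp

lemma measurableEmbedding_chamberMatrix :
    MeasurableEmbedding (Matrix.toLin' (chamberMatrix σ ℝ)) := by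
  have h := abs_det_chamberMatrix σ
  have hne : (chamberMatrix σ ℝ).det ≠ 0 := fun h0 => by simp [h0] at h
  refine (LinearMap.continuous_of_finiteDimensional _).measurableEmbedding ?_
  exact Matrix.mulVec_injective_iff_isUnit.2
    ((Matrix.isUnit_iff_isUnit_det _).2 (isUnit_iff_ne_zero.2 hne))

/-- The open Weyl chamber of `σ` in logarithmic coordinates of the affine chart. -/
def openChamber : Set (Fin m → ℝ) :=
  {y | StrictMono ((Fin.snoc y 0 : Fin (m + 1) → ℝ) ∘ σ)}

lemma continuous_snoc_zero (j : Fin (m + 1)) :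
    Continuous fun y : Fin m → ℝ => (Fin.snoc y 0 : Fin (m + 1) → ℝ) j := by
  induction j using Fin.lastCases with
  | last => simpa using continuous_const
  | cast j => simpa using continuous_apply j

lemma measurableSet_openChamber : MeasurableSet (openChamber σ) := by
  have : openChamber σ = ⋂ k : Fin m, {y | (Fin.snoc y 0 : Fin (m + 1) → ℝ) (σ k.castSucc) <
      (Fin.snoc y 0 : Fin (m + 1) → ℝ) (σ k.succ)} := by
    ext y
    simp [openChamber, Fin.strictMono_iff_lt_succ]
  rw [this]
  exact MeasurableSet.iInter fun k => measurableSet_lt (continuous_snoc_zero _).measurable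
    (continuous_snoc_zero _).measurable

lemma chamberMatrix_preimage_openChamber :
    Matrix.toLin' (chamberMatrix σ ℝ) ⁻¹' openChamber σ = negativeOrthant m := by
  ext u
  simp only [Set.mem_preimage, openChamber, Set.mem_ofPred_eq, Fin.strictMono_iff_lt_succ,
    Function.comp_apply, Matrix.toLin'_apply, snoc_chamberMatrix_mulVec,
    chamberPoint_apply_castSucc, negativeOrthant]
  refine forall_congr' fun k => ?_
  constructor <;> intro h <;> linarith

/-- A finite set of reals has only one increasing enumeration. -/
lemma pairwise_disjoint_openChamber :
    Pairwise (Function.onFun Disjoint (openChamber (m := m))) := by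
  intro σ τ hne
  refine Set.disjoint_left.2 fun y hσ hτ => hne ?_
  have hrange : Set.range ((Fin.snoc y 0 : Fin (m + 1) → ℝ) ∘ σ) =
      Set.range ((Fin.snoc y 0 : Fin (m + 1) → ℝ) ∘ τ) := by
    rw [σ.surjective.range_comp, τ.surjective.range_comp]
  have heq := (StrictMono.range_inj hσ hτ).1 hrange
  have hinj : Function.Injective (Fin.snoc y 0 : Fin (m + 1) → ℝ) :=
    ((Equiv.injective_comp σ _).1 hσ.injective)
  ext i
  exact congrArg _ (hinj (congrFun heq i))

/-- A point with distinct coordinates (the appended `0` included) is sorted into a chamber; the rest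
lies in finitely many proper subspaces. -/
lemma iUnion_openChamber_ae_eq :
    (⋃ σ : Equiv.Perm (Fin (m + 1)), openChamber σ) =ᵐ[volume] Set.univ := by
  rw [ae_eq_univ]
  refine measure_mono_null (t := ⋃ p : {p : Fin (m + 1) × Fin (m + 1) // p.1 ≠ p.2},
    {y : Fin m → ℝ | (Fin.snoc y 0 : Fin (m + 1) → ℝ) p.1.1 =
      (Fin.snoc y 0 : Fin (m + 1) → ℝ) p.1.2}) ?_ ?_
  · intro y hy
    by_contra hcon
    refine hy (Set.mem_iUnion.2 ⟨Tuple.sort (Fin.snoc y 0 : Fin (m + 1) → ℝ), ?_⟩)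
    refine (Tuple.monotone_sort _).strictMono_of_injective (Function.Injective.comp ?_
      (Equiv.injective _))
    intro i j hij
    by_contra hne
    exact hcon (Set.mem_iUnion.2 ⟨⟨(i, j), hne⟩, hij⟩)
  · refine measure_iUnion_null fun ⟨⟨i, j⟩, hij⟩ => ?_
    simp only at hij ⊢
    let V : Submodule ℝ (Fin m → ℝ) :=
      { carrier := {y | (Fin.snoc y 0 : Fin (m + 1) → ℝ) i = (Fin.snoc y 0 : Fin (m + 1) → ℝ) j}
        zero_mem' := by
          have : ∀ k, (Fin.snoc (0 : Fin m → ℝ) 0 : Fin (m + 1) → ℝ) k = 0 := by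
            intro k
            induction k using Fin.lastCases <;> simp
          simp [this]
        add_mem' := by
          intro a b ha hb
          have : ∀ k, (Fin.snoc (a + b) 0 : Fin (m + 1) → ℝ) k =
              (Fin.snoc a 0 : Fin (m + 1) → ℝ) k + (Fin.snoc b 0 : Fin (m + 1) → ℝ) k := by
            intro k
            induction k using Fin.lastCases <;> simp
          simp only [Set.mem_ofPred_eq] at ha hb ⊢
          rw [this, this, ha, hb]
        smul_mem' := by
          intro c a ha
          have : ∀ k, (Fin.snoc (c • a) 0 : Fin (m + 1) → ℝ) k =
              c * (Fin.snoc a 0 : Fin (m + 1) → ℝ) k := by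
            intro k
            induction k using Fin.lastCases <;> simp
          simp only [Set.mem_ofPred_eq] at ha ⊢
          rw [this, this, ha] }
    refine Measure.addHaar_submodule volume V fun htop => hij ?_
    -- With `0` appended, this vector is `k - m` at every index, so its coordinates are distinct and
    -- it lies outside every such hyperplane.
    have hmem : (fun k : Fin m => (k : ℝ) - m) ∈ V := htop ▸ Submodule.mem_top
    have hval : ∀ k : Fin (m + 1),
        (Fin.snoc (fun k : Fin m => (k : ℝ) - m) 0 : Fin (m + 1) → ℝ) k = (k : ℝ) - m := by
      intro k
      induction k using Fin.lastCases <;> simp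
    have h : (i : ℝ) - m = (j : ℝ) - m := by rw [← hval, ← hval]; exact hmem
    exact Fin.ext (by exact_mod_cast sub_left_injective h)

/-- Integration over the logarithmic affine chart, chamber by chamber. -/
lemma integrable_iff_forall_negativeOrthant (h : (Fin m → ℝ) → ℂ) :
    Integrable h ↔ ∀ σ : Equiv.Perm (Fin (m + 1)),
      IntegrableOn (fun u => h ((chamberMatrix σ ℝ).mulVec u)) (negativeOrthant m) := by
  rw [← integrableOn_univ, ← integrableOn_congr_set_ae iUnion_openChamber_ae_eq,
    integrableOn_finite_iUnion]
  refine forall_congr' fun σ => ?_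
  rw [← (measurePreserving_chamberMatrix σ).integrableOn_comp_preimage
    (measurableEmbedding_chamberMatrix σ), chamberMatrix_preimage_openChamber]
  rfl

lemma integral_eq_sum_negativeOrthant {h : (Fin m → ℝ) → ℂ} (hh : Integrable h) :
    ∫ y, h y = ∑ σ : Equiv.Perm (Fin (m + 1)),
      ∫ u in negativeOrthant m, h ((chamberMatrix σ ℝ).mulVec u) := by
  rw [← setIntegral_univ, ← setIntegral_congr_set iUnion_openChamber_ae_eq,
    integral_iUnion_fintype (fun σ => measurableSet_openChamber σ) pairwise_disjoint_openChamber
      fun σ => hh.integrableOn]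
  refine Finset.sum_congr rfl fun σ _ => ?_
  rw [← (measurePreserving_chamberMatrix σ).setIntegral_preimage_emb
    (measurableEmbedding_chamberMatrix σ), chamberMatrix_preimage_openChamber]
  rfl

end Chambers

/-! ### The canonical form in the affine chart -/

/-- The last coordinate is constant on the chart, so each term retaining its differential has a zero
column; only the term omitting it survives, with sign `+1`. -/
lemma canonicalForm_affineChart {m : ℕ} (t : Fin m → ℝ) :
    canonicalForm (affineChart t) chartTangent = ∏ i, (t i)⁻¹ := by
  rw [canonicalForm, Fin.sum_univ_castSucc, Finset.sum_eq_zero, zero_add]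
  · have : (Matrix.of fun i j : Fin m => (chartTangent i ((Fin.last m).succAbove j) : ℝ) /
        affineChart t ((Fin.last m).succAbove j)) = Matrix.diagonal fun i => (t i)⁻¹ := by
      ext i j
      simp only [Matrix.of_apply, chartTangent, affineChart, Fin.succAbove_last, Fin.snoc_castSucc,
        Matrix.diagonal_apply, Pi.single_apply, Fin.castSucc_inj]
      by_cases h : i = j
      · simp [h]
      · simp [h, Ne.symm h]
    rw [this, Matrix.det_diagonal]
    simp
  · intro k _
    obtain ⟨j, hj⟩ := Fin.exists_succAbove_eq (Fin.castSucc_lt_last k).ne'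
    rw [Matrix.det_eq_zero_of_column_eq_zero j, mul_zero]
    intro i
    simp [hj, chartTangent, Pi.single_apply, (Fin.castSucc_lt_last i).ne']

section LogChart

variable {m : ℕ} (g : (Fin (m + 1) → ℝ) → ℂ)

/-- The Jacobian `∏ exp (y i)` cancels the density `∏ 1 / t i` of `Ω`. -/
lemma smul_projectiveIntegrand_expScale (y : Fin m → ℝ) :
    (∏ i, (1 : Fin m → ℝ) i * expScale 1 y i) • projectiveIntegrand g (expScale 1 y) =
      g fun j => Real.exp ((Fin.snoc y 0 : Fin (m + 1) → ℝ) j) := by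
  have h1 : (∏ i, (1 : Fin m → ℝ) i * expScale 1 y i) * ∏ i, (expScale 1 y i)⁻¹ = 1 := by
    rw [← Finset.prod_mul_distrib]
    refine Finset.prod_eq_one fun i _ => ?_
    simp [expScale]
  have h2 : affineChart (expScale 1 y) =
      fun j => Real.exp ((Fin.snoc y 0 : Fin (m + 1) → ℝ) j) := by
    ext j
    induction j using Fin.lastCases <;> simp [affineChart, expScale]
  rw [projectiveIntegrand, canonicalForm_affineChart, h2, Complex.real_smul, mul_left_comm,
    ← Complex.ofReal_mul, h1]
  simp

lemma projectiveIntegrable_iff_log :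
    ProjectiveIntegrable g ↔
      Integrable fun y : Fin m → ℝ => g fun j => Real.exp ((Fin.snoc y 0 : Fin (m + 1) → ℝ) j) := by
  rw [ProjectiveIntegrable, ← image_expScale_univ,
    integrableOn_image_expScale (c := 1) (fun _ => zero_lt_one) MeasurableSet.univ, integrableOn_univ]
  simp only [smul_projectiveIntegrand_expScale]

lemma projectiveIntegral_eq_log :
    projectiveIntegral g =
      ∫ y : Fin m → ℝ, g fun j => Real.exp ((Fin.snoc y 0 : Fin (m + 1) → ℝ) j) := by
  rw [projectiveIntegral, ← image_expScale_univ,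
    integral_image_expScale (c := 1) (fun _ => zero_lt_one) MeasurableSet.univ, setIntegral_univ]
  simp only [smul_projectiveIntegrand_expScale]

end LogChart

/-! ### The sector parametrisation -/

section Sector

variable {m : ℕ} {r : Finset (Fin (m + 1)) → ℝ} (σ : Equiv.Perm (Fin (m + 1)))

lemma sectorPoint_expScale (hr : ∀ k : Fin m, 0 < r (prefixSet σ ((k : ℕ) + 1)))
    (u : Fin m → ℝ) :
    sectorPoint r σ (expScale (fun k => r (prefixSet σ ((k : ℕ) + 1))) u) =
      fun j => Real.exp (chamberPoint σ u j) := by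
  ext j
  simp only [sectorPoint, chamberPoint, Real.exp_sum, expScale]
  refine Finset.prod_congr rfl fun i _ => ?_
  rw [← Real.exp_mul]
  congr 1
  field_simp [(hr i).ne']

lemma sectorPoint_mem_expWeylChamber (hr : ∀ k : Fin m, 0 < r (prefixSet σ ((k : ℕ) + 1)))
    {ξ : Fin m → ℝ} (hξ : ∀ i, 0 < ξ i ∧ ξ i ≤ 1) : sectorPoint r σ ξ ∈ expWeylChamber σ := by
  let u : Fin m → ℝ := fun k => Real.log (ξ k) / r (prefixSet σ ((k : ℕ) + 1))
  have hu : ∀ k, u k ≤ 0 := fun k =>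
    div_nonpos_of_nonpos_of_nonneg (Real.log_nonpos (hξ k).1.le (hξ k).2) (hr k).le
  have hξu : ξ = expScale (fun k => r (prefixSet σ ((k : ℕ) + 1))) u := by
    ext k
    rw [expScale, mul_div_cancel₀ _ (hr k).ne', Real.exp_log (hξ k).1]
  rw [hξu, sectorPoint_expScale σ hr]
  refine ⟨chamberPoint σ u, ?_, rfl⟩
  have hmono : Monotone (chamberPoint σ u ∘ σ) := by
    refine Fin.monotone_iff_le_succ.2 fun k => ?_
    simp only [Function.comp_apply, chamberPoint_apply_castSucc]
    linarith [hu k]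
  exact fun i j hij => hmono hij

/-- The Jacobian is `∏ r_k exp (r_k u_k)`; its nonzero constant factor does not affect
integrability. -/
lemma integrableOn_unitCube_iff (hr : ∀ k : Fin m, 0 < r (prefixSet σ ((k : ℕ) + 1)))
    (f : (Fin (m + 1) → ℝ) → ℂ) :
    IntegrableOn (fun ξ => f (sectorPoint r σ ξ)) (unitCube m) ↔
      IntegrableOn (fun u => (Real.exp (∑ k : Fin m, r (prefixSet σ ((k : ℕ) + 1)) * u k) : ℂ) *
        f (fun j => Real.exp (chamberPoint σ u j))) (negativeOrthant m) := by
  have hprod : ∏ k : Fin m, r (prefixSet σ ((k : ℕ) + 1)) ≠ 0 :=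
    Finset.prod_ne_zero_iff.2 fun k _ => (hr k).ne'
  rw [integrableOn_congr_set_ae (image_expScale_ae_eq_unitCube hr),
    integrableOn_image_expScale hr measurableSet_negativeOrthant]
  simp only [sectorPoint_expScale σ hr, Finset.prod_mul_distrib, mul_smul, expScale,
    ← Real.exp_sum]
  rw [IntegrableOn, integrable_fun_smul_iff hprod]
  simp only [Complex.real_smul, IntegrableOn]

lemma integral_unitCube_eq (hr : ∀ k : Fin m, 0 < r (prefixSet σ ((k : ℕ) + 1)))
    (f : (Fin (m + 1) → ℝ) → ℂ) :
    ((1 / ∏ k : Fin m, r (prefixSet σ ((k : ℕ) + 1)) : ℝ) : ℂ) *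
        ∫ ξ in unitCube m, f (sectorPoint r σ ξ) =
      ∫ u in negativeOrthant m, (Real.exp (∑ k : Fin m, r (prefixSet σ ((k : ℕ) + 1)) * u k) : ℂ) *
        f (fun j => Real.exp (chamberPoint σ u j)) := by
  have hprod : ∏ k : Fin m, r (prefixSet σ ((k : ℕ) + 1)) ≠ 0 :=
    Finset.prod_ne_zero_iff.2 fun k _ => (hr k).ne'
  rw [setIntegral_congr_set (image_expScale_ae_eq_unitCube hr),
    integral_image_expScale hr measurableSet_negativeOrthant]
  simp only [sectorPoint_expScale σ hr, Finset.prod_mul_distrib, mul_smul, expScale,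
    ← Real.exp_sum]
  rw [integral_smul, ← Complex.real_smul, smul_smul, one_div_mul_cancel hprod, one_smul]
  simp only [Complex.real_smul]

end Sector

end

end TropicalSector

/-! ### The tropical integrand on a chamber, and the main theorem -/

namespace TropicalSector

section Ratio

variable {m : ℕ} {ι κ : Type*} [Fintype ι] [Fintype κ]

/-- Equality of `zA` and `zB` on the full set cancels the shift `s`: the ratio is homogeneous of
degree `0`. -/
lemma tropicalRatio_exp_chamberPoint {a : ι → MvPolynomial (Fin (m + 1)) ℂ} {ν : ι → ℂ}
    {b : κ → MvPolynomial (Fin (m + 1)) ℂ} {ρ : κ → ℂ}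
    (hν : ∀ i, 0 ≤ (ν i).re) (hρ : ∀ j, 0 ≤ (ρ j).re) {zA zB : Finset (Fin (m + 1)) → ℝ}
    (hzA : IsAssociatedFunction zA
      (weightedMinkowskiSum (fun i => (ν i).re) fun i => newtonPolytope (a i)))
    (hzB : IsAssociatedFunction zB
      (weightedMinkowskiSum (fun j => (ρ j).re) fun j => newtonPolytope (b j)))
    (huniv : zA Finset.univ = zB Finset.univ) (σ : Equiv.Perm (Fin (m + 1))) (s : ℝ)
    {u : Fin m → ℝ} (hu : ∀ i, u i ≤ 0) :
    tropicalRatio a ν b ρ (fun j => Real.exp (s + chamberPoint σ u j)) =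
      Real.exp (∑ k : Fin m, (zA (prefixSet σ ((k : ℕ) + 1)) - zB (prefixSet σ ((k : ℕ) + 1))) *
        u k) := by
  rw [tropicalRatio, prod_tropicalApprox_rpow σ hν hzA s hu, prod_tropicalApprox_rpow σ hρ hzB s hu,
    ← Real.exp_sub, huniv, add_sub_add_left_eq_sub, ← Finset.sum_sub_distrib]
  congr 1
  exact Finset.sum_congr rfl fun k _ => by ring

lemma exp_snoc_chamberMatrix_mulVec (σ : Equiv.Perm (Fin (m + 1))) (u : Fin m → ℝ) :
    (fun j => Real.exp ((Fin.snoc ((chamberMatrix σ ℝ).mulVec u) 0 : Fin (m + 1) → ℝ) j)) =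
      fun j => Real.exp (-chamberPoint σ u (Fin.last m) + chamberPoint σ u j) := by
  ext j
  rw [snoc_chamberMatrix_mulVec, sub_eq_neg_add]

end Ratio

end TropicalSector

theorem theorem6p5 {m : ℕ} {ι κ : Type*} [Fintype ι] [Fintype κ]
    (a : ι → MvPolynomial (Fin (m + 1)) ℂ) (dega : ι → ℕ) (ν : ι → ℂ)
    (b : κ → MvPolynomial (Fin (m + 1)) ℂ) (degb : κ → ℕ) (ρ : κ → ℂ)
    (ha : ∀ i, (a i).IsHomogeneous (dega i)) (hb : ∀ j, (b j).IsHomogeneous (degb j))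
    (hν : ∀ i, 0 ≤ (ν i).re) (hρ : ∀ j, 0 ≤ (ρ j).re)
    (hdeg : ∑ i, ν i * (dega i : ℂ) = ∑ j, ρ j * (degb j : ℂ))
    (A B : Set (Fin (m + 1) → ℝ))
    (hA : A = weightedMinkowskiSum (fun i => (ν i).re) (fun i => newtonPolytope (a i)))
    (hB : B = weightedMinkowskiSum (fun j => (ρ j).re) (fun j => newtonPolytope (b j)))
    (hAgp : IsGeneralizedPermutahedron A) (hBgp : IsGeneralizedPermutahedron B)
    (zA zB : Finset (Fin (m + 1)) → ℝ)
    (hzA : IsAssociatedFunction zA A) (hzB : IsAssociatedFunction zB B)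
    (R1 : Module.finrank ℝ (vectorSpan ℝ B) = m)
    (R2 : A ⊆ intrinsicInterior ℝ B)
    (r : Finset (Fin (m + 1)) → ℝ) (hr : ∀ S, r S = zA S - zB S) :
    (∀ S : Finset (Fin (m + 1)), S.Nonempty → S ≠ Finset.univ → 0 < r S) ∧
    (∀ (σ : Equiv.Perm (Fin (m + 1))) (ξ : Fin m → ℝ), (∀ i, 0 < ξ i ∧ ξ i ≤ 1) →
      sectorPoint r σ ξ ∈ expWeylChamber σ) ∧
    ∀ f : (Fin (m + 1) → ℝ) → ℂ, IsMeasurableHomogeneous f →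
      (ProjectiveIntegrable (fun x => (tropicalRatio a ν b ρ x : ℂ) * f x) ↔
        ∀ σ : Equiv.Perm (Fin (m + 1)),
          IntegrableOn (fun ξ => f (sectorPoint r σ ξ)) (unitCube m)) ∧
      (ProjectiveIntegrable (fun x => (tropicalRatio a ν b ρ x : ℂ) * f x) →
        projectiveIntegral (fun x => (tropicalRatio a ν b ρ x : ℂ) * f x) =
          ∑ σ : Equiv.Perm (Fin (m + 1)),
            ((1 / ∏ k : Fin m, r (prefixSet σ ((k : ℕ) + 1)) : ℝ) : ℂ) *
              ∫ ξ in unitCube m, f (sectorPoint r σ ξ)) := by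
  have hpos : ∀ S : Finset (Fin (m + 1)), S.Nonempty → S ≠ Finset.univ → 0 < r S := by
    intro S hS hS'
    obtain ⟨v, hv, hvS⟩ := exists_mem_facetPolytope_sum_eq hzA.empty hzA.supermodular S
    rw [← hzA.eq_facetPolytope] at hv
    have hvB := R2 hv
    rw [hzB.eq_facetPolytope] at R1 hvB
    rw [hr, ← hvS, sub_pos]
    exact lt_sum_of_mem_intrinsicInterior R1 hvB hS hS'
  -- Since `A ⊆ B`, a point of `A` has both values as its coordinate sum.
  have huniv : zA Finset.univ = zB Finset.univ := by
    have hv := greedyVertex_mem 1 hzA.empty hzA.supermodular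
    have hvB := hv
    rw [← hzA.eq_facetPolytope] at hvB
    have hvB := intrinsicInterior_subset (R2 hvB)
    rw [hzB.eq_facetPolytope] at hvB
    exact hv.1.symm.trans hvB.1
  have hprefix : ∀ (σ : Equiv.Perm (Fin (m + 1))) (k : Fin m),
      0 < r (prefixSet σ ((k : ℕ) + 1)) := by
    intro σ k
    -- The prefix of length `k + 1 ≤ m` contains `σ 0` and misses `σ (Fin.last m)`.
    refine hpos _ ⟨σ 0, by simp⟩ fun h => ?_
    have := h ▸ Finset.mem_univ (σ (Fin.last m))
    simp at this
    omega
  refine ⟨hpos, fun σ ξ hξ => sectorPoint_mem_expWeylChamber σ (hprefix σ) hξ, fun f hf => ?_⟩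
  subst hA hB
  -- The two integrands agree pointwise on each chamber; this gives both the convergence criterion
  -- and the formula.
  have hchart : ∀ (σ : Equiv.Perm (Fin (m + 1))), ∀ u ∈ negativeOrthant m,
      (fun x => (tropicalRatio a ν b ρ x : ℂ) * f x) (fun j =>
        Real.exp ((Fin.snoc ((chamberMatrix σ ℝ).mulVec u) 0 : Fin (m + 1) → ℝ) j)) =
      (Real.exp (∑ k : Fin m, r (prefixSet σ ((k : ℕ) + 1)) * u k) : ℂ) *
        f (fun j => Real.exp (chamberPoint σ u j)) := by
    intro σ u hu
    simp only [exp_snoc_chamberMatrix_mulVec, hr]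
    rw [tropicalRatio_exp_chamberPoint hν hρ hzA hzB huniv σ _ fun i => (hu i).le]
    congr 1
    -- The chart normalises the last coordinate to `1`, the sector normalises `x_{σ(n)}`; the two
    -- points differ by this positive scaling.
    rw [← hf.homogeneous (Real.exp (-chamberPoint σ u (Fin.last m))) (Real.exp_pos _)
      (fun j => Real.exp (chamberPoint σ u j)) fun j => Real.exp_pos _]
    congr 1
    ext j
    simp [Real.exp_add]
  constructor
  · rw [projectiveIntegrable_iff_log, integrable_iff_forall_negativeOrthant]
    refine forall_congr' fun σ => ?_
    rw [integrableOn_unitCube_iff σ (hprefix σ)]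
    exact integrableOn_congr_fun (hchart σ) measurableSet_negativeOrthant
  · intro hint
    rw [projectiveIntegral_eq_log,
      integral_eq_sum_negativeOrthant ((projectiveIntegrable_iff_log _).1 hint)]
    refine Finset.sum_congr rfl fun σ _ => ?_
    rw [integral_unitCube_eq σ (hprefix σ)]
    exact setIntegral_congr_fun measurableSet_negativeOrthant (hchart σ)
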